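/- Let $X=\{X_s : s\ge 0\}$ be the continuous-time symmetric simple random walk on $\mathbb Z$ with jump rates $\lambda(x,y)=1/2$ if $|x-y|=1$ and $\lambda(x,y)=0$ otherwise, i.e. the càdlàg Markov process on $\mathbb Z$ with generator $Lf(x)=\tfrac12[f(x+1)-f(x)]+\tfrac12[f(x-1)-f(x)]$. Let $\mathbb E_x$ denote expectation for the walk started from $x\in\mathbb Z$, and let $\xi(y,s)=\int_0^s \mathbf 1_{\{X_r=y\}}\,dr$ be the local time at $y\in\mathbb Z$ up to time $s$. Then for every $t\ge 0$ there is a constant $C=C(t)>0$ such that, for every $x\in\mathbb Z$ and every integer $n\ge 1$, \[ \mathbb E_x\Big[\Big(\frac{\xi(0,tn^2)}{n}-\frac{\xi(-1,tn^2)}{n}\Big)^2\Big]\le \frac{C}{n} \qquad\text{and}\qquad \mathbb E_x\Big[\Big|\frac{\xi(0,tn^2)}{n}-\frac{\xi(-1,tn^2)}{n}\Big|\Big]\le \frac{C}{\sqrt n}. \] -/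

import Mathlib

open MeasureTheory ProbabilityTheory Filter Topology
open scoped NNReal

noncomputable section

namespace SimpleRandomWalk

/-- The generator of the continuous-time symmetric simple random walk on `ℤ`, with jump rate `1/2`
from each site to each of its two neighbours. -/
def generator (f : ℤ → ℝ) (x : ℤ) : ℝ :=
  1 / 2 * (f (x + 1) - f x) + 1 / 2 * (f (x - 1) - f x)

/-- The Markov semigroup `e^{tL} f = ∑ₖ tᵏ/k! Lᵏ f` with generator `L`. It is used for bounded `f`,
where `|Lᵏ f| ≤ 2ᵏ sup |f|`, so that the series converges absolutely. -/
def semigroup (t : ℝ≥0) (f : ℤ → ℝ) (x : ℤ) : ℝ :=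
  ∑' k : ℕ, (t : ℝ) ^ k / (k.factorial : ℝ) * (generator^[k] f) x

variable {Ω : Type*} [MeasurableSpace Ω]

/-- The information `σ(X_r : r ≤ s)` generated by the process up to time `s`. -/
@[reducible]
def history (X : ℝ≥0 → Ω → ℤ) (s : ℝ≥0) : MeasurableSpace Ω :=
  ⨆ r : Set.Iic s, MeasurableSpace.comap (X r) ⊤

/-- Under `P`, the process `X` is a continuous-time symmetric simple random walk on `ℤ` started
from `x`: a càdlàg Markov process with semigroup `e^{tL}`. -/
structure IsWalk (X : ℝ≥0 → Ω → ℤ) (P : Measure Ω) (x : ℤ) : Prop where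
  isProbabilityMeasure : IsProbabilityMeasure P
  measurable : ∀ t, Measurable (X t)
  rightContinuous : ∀ ω t, ContinuousWithinAt (fun s => X s ω) (Set.Ici t) t
  leftLimit : ∀ ω t, ∃ y : ℤ, Tendsto (fun s => X s ω) (𝓝[<] t) (𝓝 y)
  start : ∀ᵐ ω ∂P, X 0 ω = x
  markov : ∀ (s t : ℝ≥0) (f : ℤ → ℝ), (∃ M : ℝ, ∀ y, |f y| ≤ M) →
    P[fun ω => f (X (s + t) ω) | history X s] =ᵐ[P] fun ω => semigroup t f (X s ω)

/-- The local time `ξ(y, t) = ∫₀ᵗ 𝟙_{y}(X_s) ds` of the process `X` at the site `y`. -/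
def localTime (X : ℝ≥0 → Ω → ℤ) (y : ℤ) (t : ℝ≥0) (ω : Ω) : ℝ :=
  ∫ s in (0 : ℝ)..t, Set.indicator {y} (fun _ => (1 : ℝ)) (X s.toNNReal ω)

end SimpleRandomWalk

end

/-!
Let `L` be the generator and `g` the bounded step function with jump at `0`, for which
`L g = 𝟙_{0} - 𝟙_{-1}`. Then `ξ(0, T) - ξ(-1, T) = ∫₀ᵀ L g(X_s) ds`, and squaring,
`E(∫₀ᵀ L g(X_s) ds)² = 2 ∫₀ᵀ E[L g(X_s) ∫ₛᵀ L g(X_r) dr] ds`. By the Markov property at time `s` and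
Dynkin's formula, the inner integral may be replaced by `g(X_T) - g(X_s)`, which is at most `2`, so
that the second moment is bounded by the expected occupation time of `{0, -1}`, up to a constant.
That occupation time is controlled by Dynkin's formula for `f(z) = -(1 - δ)^|z - y| / δ`, which
satisfies `𝟙_{y} ≤ δ / 2 + L f` and has oscillation at most `1 / δ`; this gives `1 / δ + δ T / 2`.
With `T = t n²` and `δ = 1 / n` the bound is of order `n`. The first moment follows by Jensen's
inequality.
-/

noncomputable section

open scoped BoundedContinuousFunction

section ExponentialFlow

variable {E : Type*} [NormedAddCommGroup E] [NormedSpace ℝ E] [CompleteSpace E]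

/-- The value at time `t` of the uniformly continuous group `e^{tA}` generated by the bounded
operator `A`; `t ↦ expFlow A t f` solves `u' = A u`, `u(0) = f`. -/
def expFlow (A : E →L[ℝ] E) (t : ℝ) : E →L[ℝ] E := NormedSpace.exp (t • A)

lemma hasSum_expFlow_apply (A : E →L[ℝ] E) (t : ℝ) (f : E) :
    HasSum (fun k : ℕ => (t ^ k / (k.factorial : ℝ)) • (A ^ k) f) (expFlow A t f) := by
  have hsum := (NormedSpace.exp_series_hasSum_exp' (𝕂 := ℝ) (t • A)).mapL
    (ContinuousLinearMap.apply ℝ E f)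
  refine hsum.congr_fun fun k => ?_
  simp [smul_pow, smul_smul, div_eq_inv_mul]

lemma hasDerivAt_expFlow_apply (A : E →L[ℝ] E) (t : ℝ) (f : E) :
    HasDerivAt (fun r => expFlow A r f) (expFlow A t (A f)) t :=
  (ContinuousLinearMap.apply ℝ E f).hasFDerivAt.comp_hasDerivAt t (hasDerivAt_exp_smul_const A t)

lemma continuous_expFlow_apply (A : E →L[ℝ] E) (f : E) : Continuous fun r => expFlow A r f :=
  continuous_iff_continuousAt.2 fun t => (hasDerivAt_expFlow_apply A t f).continuousAt

lemma integral_expFlow_apply (A : E →L[ℝ] E) (t : ℝ) (f : E) :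
    ∫ r in (0 : ℝ)..t, expFlow A r (A f) = expFlow A t f - f := by
  rw [intervalIntegral.integral_eq_sub_of_hasDerivAt
    (fun r _ => hasDerivAt_expFlow_apply A r f)
    ((continuous_expFlow_apply A (A f)).intervalIntegrable _ _)]
  simp [expFlow]

end ExponentialFlow

section SquareOfIntegral

open Set

lemma integral_integral_eq_two_mul_of_symm {ι : Type*} [LinearOrder ι] [TopologicalSpace ι]
    [OrderClosedTopology ι] [SecondCountableTopology ι] [MeasurableSpace ι] [OpensMeasurableSpace ι]
    {ν : Measure ι} [SFinite ν] [NullSingletonClass ν] {K : ι → ι → ℝ}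
    (hK : Integrable (Function.uncurry K) (ν.prod ν)) (hsymm : ∀ s r, K s r = K r s) :
    ∫ s, ∫ r, K s r ∂ν ∂ν = 2 * ∫ s, ∫ r in Ioi s, K s r ∂ν ∂ν := by
  let upper : Set (ι × ι) := {p | p.1 < p.2}
  have hupper : MeasurableSet upper := measurableSet_lt measurable_fst measurable_snd
  have hsection : ∀ s, ∫ r, upper.indicator (Function.uncurry K) (s, r) ∂ν =
      ∫ r in Ioi s, K s r ∂ν := fun s => by
    rw [← integral_indicator measurableSet_Ioi]
    rfl
  have hsection' : ∀ r, ∫ s, upperᶜ.indicator (Function.uncurry K) (s, r) ∂ν =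
      ∫ s in Ioi r, K r s ∂ν := fun r => by
    rw [setIntegral_congr_set Ioi_ae_eq_Ici, ← integral_indicator measurableSet_Ici]
    congr 1 with s
    by_cases h : r ≤ s <;> simp [upper, h, hsymm s r]
  calc ∫ s, ∫ r, K s r ∂ν ∂ν
      = ∫ p, Function.uncurry K p ∂ν.prod ν := (integral_prod _ hK).symm
    _ = ∫ p, upper.indicator (Function.uncurry K) p ∂ν.prod ν +
          ∫ p, upperᶜ.indicator (Function.uncurry K) p ∂ν.prod ν := by
        rw [integral_indicator hupper, integral_indicator hupper.compl,
          integral_add_compl hupper hK]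
    _ = 2 * ∫ s, ∫ r in Ioi s, K s r ∂ν ∂ν := by
        rw [integral_prod _ (hK.indicator hupper),
          integral_prod_symm _ (hK.indicator hupper.compl)]
        simp only [hsection, hsection', two_mul]

variable {Ω : Type*} [MeasurableSpace Ω] {P : Measure Ω} [IsFiniteMeasure P]

lemma integral_sq_intervalIntegral {Y : ℝ → Ω → ℝ} {C a b : ℝ}
    (hY : Measurable (Function.uncurry Y)) (hC : ∀ s ω, |Y s ω| ≤ C) (hab : a ≤ b) :
    ∫ ω, (∫ s in a..b, Y s ω) ^ 2 ∂P =
      2 * ∫ s in a..b, ∫ r in s..b, ∫ ω, Y s ω * Y r ω ∂P := by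
  set ν : Measure ℝ := volume.restrict (Ioc a b) with hν
  have hprod : Integrable (fun q : Ω × (ℝ × ℝ) => Y q.2.1 q.1 * Y q.2.2 q.1)
      (P.prod (ν.prod ν)) := by
    refine Integrable.of_bound (Measurable.aestronglyMeasurable ?_) (C * C)
      (ae_of_all _ fun q => ?_)
    · exact (hY.comp (by fun_prop : Measurable fun q : Ω × (ℝ × ℝ) => (q.2.1, q.1))).mul
        (hY.comp (by fun_prop : Measurable fun q : Ω × (ℝ × ℝ) => (q.2.2, q.1)))
    · rw [norm_mul]
      exact mul_le_mul (hC _ _) (hC _ _) (norm_nonneg _) ((abs_nonneg _).trans (hC 0 q.1))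
  have hcorr : Integrable (Function.uncurry fun s r => ∫ ω, Y s ω * Y r ω ∂P) (ν.prod ν) :=
    hprod.integral_prod_right
  calc ∫ ω, (∫ s in a..b, Y s ω) ^ 2 ∂P
      = ∫ ω, ∫ p, Y p.1 ω * Y p.2 ω ∂ν.prod ν ∂P := by
        refine integral_congr_ae (ae_of_all _ fun ω => ?_)
        simp only [intervalIntegral.integral_of_le hab, sq, ← hν]
        exact (integral_prod_mul (fun s => Y s ω) (fun s => Y s ω)).symm
    _ = ∫ s, ∫ r, ∫ ω, Y s ω * Y r ω ∂P ∂ν ∂ν := by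
        rw [integral_integral_swap hprod]
        exact integral_prod _ hcorr
    _ = 2 * ∫ s, ∫ r in Ioi s, ∫ ω, Y s ω * Y r ω ∂P ∂ν ∂ν :=
        integral_integral_eq_two_mul_of_symm hcorr fun s r => by simp only [mul_comm]
    _ = 2 * ∫ s in a..b, ∫ r in s..b, ∫ ω, Y s ω * Y r ω ∂P := by
        rw [intervalIntegral.integral_of_le hab]
        congr 1
        refine setIntegral_congr_fun measurableSet_Ioc fun s hs => ?_
        simp only [hν]
        rw [Measure.restrict_restrict measurableSet_Ioi, inter_comm, Ioc_inter_Ioi,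
          sup_eq_right.2 hs.1.le, intervalIntegral.integral_of_le hs.2]

end SquareOfIntegral

lemma integral_abs_le_sqrt_integral_sq {Ω : Type*} [MeasurableSpace Ω] {P : Measure Ω}
    [IsProbabilityMeasure P] {Z : Ω → ℝ} (hZ : MemLp Z 2 P) :
    ∫ ω, |Z ω| ∂P ≤ √(∫ ω, Z ω ^ 2 ∂P) := by
  refine Real.le_sqrt_of_sq_le ?_
  have h : 0 ≤ Var[|Z|; P] := variance_nonneg |Z| P
  rw [variance_eq_sub hZ.abs] at h
  simpa only [Pi.pow_apply, Pi.abs_apply, sq_abs, sub_nonneg] using h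

section BoundedTestFunctions

variable {Ω E : Type*} [MeasurableSpace Ω] [TopologicalSpace E] [MeasurableSpace E]
  [OpensMeasurableSpace E] {P : Measure Ω} {Y : Ω → ℝ} {Z : Ω → E}

lemma integrable_mul_boundedContinuous_comp (hY : Integrable Y P) (hZ : Measurable Z)
    (f : E →ᵇ ℝ) : Integrable (fun ω => Y ω * f (Z ω)) P :=
  hY.mul_bdd (c := ‖f‖) (f.continuous.measurable.comp hZ).aestronglyMeasurable
    (ae_of_all _ fun _ => f.norm_coe_le_norm _)

lemma exists_clm_eq_integral_mul_comp (hY : Integrable Y P) (hZ : Measurable Z) :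
    ∃ ℓ : (E →ᵇ ℝ) →L[ℝ] ℝ, ∀ f, ℓ f = ∫ ω, Y ω * f (Z ω) ∂P := by
  refine ⟨LinearMap.mkContinuous
    { toFun := fun f => ∫ ω, Y ω * f (Z ω) ∂P
      map_add' := fun f g => ?_
      map_smul' := fun c f => ?_ } (∫ ω, |Y ω| ∂P) fun f => ?_, fun f => rfl⟩
  · simp only [BoundedContinuousFunction.add_apply, mul_add]
    exact integral_add (integrable_mul_boundedContinuous_comp hY hZ f)
      (integrable_mul_boundedContinuous_comp hY hZ g)
  · simp only [BoundedContinuousFunction.smul_apply, smul_eq_mul, mul_left_comm _ c,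
      integral_const_mul, RingHom.id_apply]
  · rw [← integral_mul_const]
    refine norm_integral_le_of_norm_le (hY.abs.mul_const _) (ae_of_all _ fun ω => ?_)
    rw [norm_mul]
    exact mul_le_mul_of_nonneg_left (f.norm_coe_le_norm _) (norm_nonneg _)

end BoundedTestFunctions

lemma tendsto_nat_ceil_mul_div_nhdsGE (s : ℝ≥0) :
    Tendsto (fun k : ℕ => (⌈s * (k : ℝ≥0)⌉₊ : ℝ≥0) / k) atTop (𝓝[≥] s) := by
  refine tendsto_nhdsWithin_iff.2 ⟨?_, ?_⟩
  · rw [← NNReal.tendsto_coe]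
    refine ((tendsto_nat_ceil_mul_div_atTop s.coe_nonneg).comp
      (tendsto_natCast_atTop_atTop (R := ℝ))).congr fun k => ?_
    have hceil : ⌈(s : ℝ) * k⌉₊ = ⌈s * (k : ℝ≥0)⌉₊ := Nonneg.nat_ceil_coe (s * (k : ℝ≥0))
    simp only [Function.comp_apply, NNReal.coe_div, NNReal.coe_natCast, hceil]
  · filter_upwards [eventually_gt_atTop 0] with k hk
    have hk' : (0 : ℝ≥0) < k := Nat.cast_pos.2 hk
    exact (le_div_iff₀ hk').2 (Nat.le_ceil _)

lemma measurable_uncurry_of_rightContinuous {Ω E : Type*} [MeasurableSpace Ω]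
    [TopologicalSpace E] [TopologicalSpace.PseudoMetrizableSpace E] [MeasurableSpace E]
    [BorelSpace E] {X : ℝ≥0 → Ω → E} (hX : ∀ t, Measurable (X t))
    (hright : ∀ ω t, ContinuousWithinAt (fun s => X s ω) (Set.Ici t) t) :
    Measurable (Function.uncurry X) := by
  refine measurable_of_tendsto_metrizable
    (f := fun (k : ℕ) (p : ℝ≥0 × Ω) => X (⌈p.1 * (k : ℝ≥0)⌉₊ / k) p.2) (fun k => ?_)
    (tendsto_pi_nhds.2 fun p =>
      (hright p.2 p.1).tendsto.comp (tendsto_nat_ceil_mul_div_nhdsGE p.1))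
  have hdiscrete : Measurable fun q : ℕ × Ω => X ((q.1 : ℝ≥0) / k) q.2 :=
    measurable_from_prod_countable_right fun m => hX (m / k)
  have hceil : Measurable fun p : ℝ≥0 × Ω => ⌈p.1 * (k : ℝ≥0)⌉₊ :=
    Nat.measurable_ceil.comp (measurable_fst.mul_const _)
  exact hdiscrete.comp (hceil.prodMk measurable_snd)

namespace SimpleRandomWalk

/-- The generator `L` of the walk as a bounded operator on the Banach space of bounded functions. -/
def generatorCLM : (ℤ →ᵇ ℝ) →L[ℝ] (ℤ →ᵇ ℝ) :=
  (1 / 2 : ℝ) • (BoundedContinuousFunction.compContinuousCLM ℝ ℝ (ContinuousMap.addRight 1) - 1) +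
    (1 / 2 : ℝ) •
      (BoundedContinuousFunction.compContinuousCLM ℝ ℝ (ContinuousMap.addRight (-1)) - 1)

lemma coe_generatorCLM (f : ℤ →ᵇ ℝ) : ⇑(generatorCLM f) = generator f := by
  ext x
  simp [generatorCLM, generator, sub_eq_add_neg, mul_add]

lemma coe_generatorCLM_pow (k : ℕ) (f : ℤ →ᵇ ℝ) :
    ⇑((generatorCLM ^ k) f) = generator^[k] f := by
  induction k with
  | zero => rfl
  | succ k ih =>
    rw [Function.iterate_succ_apply', pow_succ', mul_apply_eq_comp, coe_generatorCLM, ih]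

lemma abs_generator_le (f : ℤ →ᵇ ℝ) (z : ℤ) : |generator f z| ≤ ‖generatorCLM f‖ := by
  rw [← coe_generatorCLM]
  exact (generatorCLM f).norm_coe_le_norm z

lemma semigroup_eq_expFlow (t : ℝ≥0) (f : ℤ →ᵇ ℝ) :
    semigroup t f = expFlow generatorCLM t f := by
  ext x
  have hsum := (hasSum_expFlow_apply generatorCLM t f).mapL
    (BoundedContinuousFunction.evalCLM ℝ x)
  refine Eq.trans (tsum_congr fun k => ?_) hsum.tsum_eq
  rw [← coe_generatorCLM_pow]
  rfl

lemma abs_indicator_singleton_le (y z : ℤ) :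
    |Set.indicator {y} (fun _ => (1 : ℝ)) z| ≤ 1 := by
  by_cases h : z = y <;> simp [h]

lemma generator_step (y z : ℤ) :
    generator (fun z => if y ≤ z then -1 else 1) z =
      Set.indicator {y} (fun _ => (1 : ℝ)) z - Set.indicator {y - 1} (fun _ => (1 : ℝ)) z := by
  simp only [generator, Set.indicator_apply, Set.mem_singleton_iff]
  split_ifs <;> first | omega | norm_num

lemma indicator_singleton_le_generator_potential {δ : ℝ} (hδ : 0 < δ) (hδ' : δ ≤ 1) (y z : ℤ) :
    Set.indicator {y} (fun _ => (1 : ℝ)) z ≤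
      δ / 2 + generator (fun z => -(1 - δ) ^ (z - y).natAbs / δ) z := by
  rcases eq_or_ne z y with rfl | hzy
  · have hgen : generator (fun w => -(1 - δ) ^ (w - z).natAbs / δ) z = 1 := by
      have hright : (z + 1 - z).natAbs = 1 := by omega
      have hleft : (z - 1 - z).natAbs = 1 := by omega
      simp only [generator, hright, hleft, sub_self, Int.natAbs_zero]
      field_simp
      ring
    rw [Set.indicator_of_mem (Set.mem_singleton z), hgen]
    linarith
  · obtain ⟨k, hk⟩ : ∃ k : ℕ, (z - y).natAbs = k + 1 := ⟨(z - y).natAbs - 1, by omega⟩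
    have hgen : generator (fun w => -(1 - δ) ^ (w - y).natAbs / δ) z =
        -((1 - δ) ^ k * (δ / 2)) := by
      have hneighbours : (z + 1 - y).natAbs = k + 2 ∧ (z - 1 - y).natAbs = k ∨
          (z + 1 - y).natAbs = k ∧ (z - 1 - y).natAbs = k + 2 := by omega
      rcases hneighbours with ⟨hright, hleft⟩ | ⟨hright, hleft⟩ <;>
      · simp only [generator, hk, hright, hleft]
        field_simp
        ring
    have hpow : (1 - δ) ^ k ≤ 1 := pow_le_one₀ (by linarith) (by linarith)
    rw [Set.indicator_of_notMem (by simpa using hzy), hgen]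
    linarith [mul_le_of_le_one_left (half_pos hδ).le hpow]

variable {Ω : Type*}

lemma abs_localTime_le (X : ℝ≥0 → Ω → ℤ) (y : ℤ) (T : ℝ≥0) (ω : Ω) :
    |localTime X y T ω| ≤ T := by
  have h := intervalIntegral.norm_integral_le_of_norm_le_const (a := 0) (b := (T : ℝ))
    (f := fun s => Set.indicator {y} (fun _ => (1 : ℝ)) (X s.toNNReal ω)) (C := 1)
    fun s _ => abs_indicator_singleton_le y _
  rwa [sub_zero, one_mul, abs_of_nonneg T.coe_nonneg] at h

lemma measurable_history (X : ℝ≥0 → Ω → ℤ) (s : ℝ≥0) : Measurable[history X s] (X s) :=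
  (comap_measurable (X s)).mono
    (le_iSup (fun r : Set.Iic s => MeasurableSpace.comap (X r) ⊤) ⟨s, Set.self_mem_Iic⟩) le_rfl

variable [MeasurableSpace Ω] {X : ℝ≥0 → Ω → ℤ} {P : Measure Ω} {x : ℤ}

namespace IsWalk

lemma history_le (hX : IsWalk X P x) (s : ℝ≥0) : history X s ≤ ‹MeasurableSpace Ω› :=
  iSup_le fun r => (hX.measurable r).comap_le

lemma measurable_comp_uncurry (hX : IsWalk X P x) (φ : ℤ → ℝ) :
    Measurable (Function.uncurry fun (s : ℝ) ω => φ (X s.toNNReal ω)) :=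
  measurable_from_top.comp <|
    (measurable_uncurry_of_rightContinuous hX.measurable hX.rightContinuous).comp
      (measurable_fst.real_toNNReal.prodMk measurable_snd)

section BoundedFunctionals

variable {φ : ℤ → ℝ} {C : ℝ}

lemma integrable_comp (hX : IsWalk X P x) (hφ : ∀ z, |φ z| ≤ C) (s : ℝ≥0) :
    Integrable (fun ω => φ (X s ω)) P :=
  have := hX.isProbabilityMeasure
  .of_bound (measurable_from_top.comp (hX.measurable s)).aestronglyMeasurable C
    (ae_of_all _ fun _ => hφ _)

lemma intervalIntegrable_comp (hX : IsWalk X P x) (hφ : ∀ z, |φ z| ≤ C) (ω : Ω) (a b : ℝ) :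
    IntervalIntegrable (fun s : ℝ => φ (X s.toNNReal ω)) volume a b :=
  (intervalIntegrable_const (c := C)).mono_fun'
    ((hX.measurable_comp_uncurry φ).comp measurable_prodMk_right).aestronglyMeasurable
    (ae_of_all _ fun _ => hφ _)

lemma intervalIntegrable_integral_comp (hX : IsWalk X P x) (hφ : ∀ z, |φ z| ≤ C) (a b : ℝ) :
    IntervalIntegrable (fun s : ℝ => ∫ ω, φ (X s.toNNReal ω) ∂P) volume a b := by
  have := hX.isProbabilityMeasure
  refine (intervalIntegrable_const (c := C)).mono_fun'
    (hX.measurable_comp_uncurry φ).stronglyMeasurable.integral_prod_right.aestronglyMeasurable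
    (ae_of_all _ fun s => ?_)
  simpa using norm_integral_le_of_norm_le_const (μ := P) (f := fun ω => φ (X s.toNNReal ω))
    (ae_of_all _ fun _ => hφ _)

end BoundedFunctionals

section Dynkin

variable {Y : Ω → ℝ} {s t : ℝ≥0}

lemma integral_mul_comp_add (hX : IsWalk X P x) (hY : Integrable Y P)
    (hYs : StronglyMeasurable[history X s] Y) (u : ℝ≥0) (f : ℤ →ᵇ ℝ) :
    ∫ ω, Y ω * f (X (s + u) ω) ∂P = ∫ ω, Y ω * semigroup u f (X s ω) ∂P := by
  have := hX.isProbabilityMeasure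
  have hf : ∀ z, |f z| ≤ ‖f‖ := f.norm_coe_le_norm
  have hpull := condExp_mul_of_stronglyMeasurable_left (μ := P) hYs
    (integrable_mul_boundedContinuous_comp hY (hX.measurable (s + u)) f)
    (hX.integrable_comp hf (s + u))
  rw [← integral_condExp (hX.history_le s)]
  refine integral_congr_ae ?_
  filter_upwards [hpull, hX.markov s u f ⟨‖f‖, hf⟩] with ω hω hmarkov
  rw [← hmarkov]
  exact hω

lemma integral_integral_mul_generator (hX : IsWalk X P x) (hst : s ≤ t) (hY : Integrable Y P)
    (hYs : StronglyMeasurable[history X s] Y) (f : ℤ →ᵇ ℝ) :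
    ∫ r in (s : ℝ)..t, ∫ ω, Y ω * generator f (X r.toNNReal ω) ∂P =
      ∫ ω, Y ω * (f (X t ω) - f (X s ω)) ∂P := by
  obtain ⟨ℓ, hℓ⟩ := exists_clm_eq_integral_mul_comp hY (hX.measurable s)
  have hmarkov : ∀ (r : ℝ≥0), s ≤ r → ∀ g : ℤ →ᵇ ℝ, ∫ ω, Y ω * g (X r ω) ∂P =
      ℓ (expFlow generatorCLM (r - s) g) := fun r hr g => by
    rw [hℓ, ← NNReal.coe_sub hr, ← semigroup_eq_expFlow, ← hX.integral_mul_comp_add hY hYs,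
      add_tsub_cancel_of_le hr]
  calc ∫ r in (s : ℝ)..t, ∫ ω, Y ω * generator f (X r.toNNReal ω) ∂P
      = ∫ r in (s : ℝ)..t, ℓ (expFlow generatorCLM (r - s) (generatorCLM f)) := by
        refine intervalIntegral.integral_congr fun r hr => ?_
        rw [Set.uIcc_of_le (NNReal.coe_le_coe.2 hst)] at hr
        have hmarkov_r := hmarkov r.toNNReal (NNReal.le_toNNReal_of_coe_le hr.1) (generatorCLM f)
        rwa [Real.coe_toNNReal r (s.coe_nonneg.trans hr.1), coe_generatorCLM] at hmarkov_r
    _ = ∫ r in (0 : ℝ)..t - s, ℓ (expFlow generatorCLM r (generatorCLM f)) := by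
        rw [intervalIntegral.integral_comp_sub_right
          (fun r => ℓ (expFlow generatorCLM r (generatorCLM f))), sub_self]
    _ = ℓ (expFlow generatorCLM (t - s) f - f) := by
        rw [ℓ.intervalIntegral_comp_comm
          ((continuous_expFlow_apply _ _).intervalIntegrable _ _), integral_expFlow_apply]
    _ = ∫ ω, Y ω * (f (X t ω) - f (X s ω)) ∂P := by
        rw [map_sub, ← hmarkov t hst, hℓ, ← integral_sub
          (integrable_mul_boundedContinuous_comp hY (hX.measurable t) f)
          (integrable_mul_boundedContinuous_comp hY (hX.measurable s) f)]
        simp only [mul_sub]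

lemma abs_integral_integral_mul_generator_le (hX : IsWalk X P x) (hst : s ≤ t)
    (hY : Integrable Y P) (hYs : StronglyMeasurable[history X s] Y) (f : ℤ →ᵇ ℝ) :
    |∫ r in (s : ℝ)..t, ∫ ω, Y ω * generator f (X r.toNNReal ω) ∂P| ≤
      2 * ‖f‖ * ∫ ω, |Y ω| ∂P := by
  rw [hX.integral_integral_mul_generator hst hY hYs, ← integral_const_mul]
  refine norm_integral_le_of_norm_le (G := ℝ) (hY.abs.const_mul _) (ae_of_all _ fun ω => ?_)
  rw [norm_mul, mul_comm]
  exact mul_le_mul_of_nonneg_right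
    ((dist_eq_norm (f (X t ω)) (f (X s ω))).symm.trans_le (f.dist_le_two_norm _ _))
    (abs_nonneg (Y ω))

end Dynkin

lemma integral_sq_integral_generator_le (hX : IsWalk X P x) (f : ℤ →ᵇ ℝ) (T : ℝ≥0) :
    ∫ ω, (∫ s in (0 : ℝ)..T, generator f (X s.toNNReal ω)) ^ 2 ∂P ≤
      4 * ‖f‖ * ∫ s in (0 : ℝ)..T, ∫ ω, |generator f (X s.toNNReal ω)| ∂P := by
  have := hX.isProbabilityMeasure
  have hgen := abs_generator_le f
  have hfuture : ∀ s ∈ Set.Ioc (0 : ℝ) T, ‖∫ r in s..T, ∫ ω,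
      generator f (X s.toNNReal ω) * generator f (X r.toNNReal ω) ∂P‖ ≤
        2 * ‖f‖ * ∫ ω, |generator f (X s.toNNReal ω)| ∂P := fun s hs => by
    have hdynkin := hX.abs_integral_integral_mul_generator_le (Real.toNNReal_le_iff_le_coe.2 hs.2)
      (hX.integrable_comp hgen s.toNNReal)
      ((measurable_from_top (f := generator f)).comp
        (measurable_history X s.toNNReal)).stronglyMeasurable f
    rwa [Real.coe_toNNReal s hs.1.le] at hdynkin
  have hint : IntervalIntegrable (fun s : ℝ => ∫ ω, |generator f (X s.toNNReal ω)| ∂P)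
      volume 0 T :=
    hX.intervalIntegrable_integral_comp (φ := fun z => |generator f z|)
      (fun z => (abs_abs _).trans_le (hgen z)) 0 T
  rw [integral_sq_intervalIntegral (hX.measurable_comp_uncurry _) (fun _ _ => hgen _)
    T.coe_nonneg]
  calc _ ≤ 2 * ∫ s in (0 : ℝ)..T, 2 * ‖f‖ * ∫ ω, |generator f (X s.toNNReal ω)| ∂P := by
        gcongr
        exact (le_abs_self _).trans <| intervalIntegral.norm_integral_le_of_norm_le T.coe_nonneg
          (ae_of_all _ hfuture) (hint.const_mul _)
    _ = _ := by
        rw [intervalIntegral.integral_const_mul]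
        ring

lemma integral_integral_comp_le (hX : IsWalk X P x) {φ : ℤ → ℝ} {c C : ℝ} {f : ℤ →ᵇ ℝ}
    (hφ : ∀ z, |φ z| ≤ C) (h : ∀ z, φ z ≤ c + generator f z) (T : ℝ≥0) :
    ∫ s in (0 : ℝ)..T, ∫ ω, φ (X s.toNNReal ω) ∂P ≤ T * c + ∫ ω, f (X T ω) - f (X 0 ω) ∂P := by
  have := hX.isProbabilityMeasure
  have hgen := abs_generator_le f
  have hgenint := hX.intervalIntegrable_integral_comp hgen 0 T
  calc ∫ s in (0 : ℝ)..T, ∫ ω, φ (X s.toNNReal ω) ∂P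
      ≤ ∫ s in (0 : ℝ)..T, (c + ∫ ω, generator f (X s.toNNReal ω) ∂P) := by
        refine intervalIntegral.integral_mono_on T.coe_nonneg
          (hX.intervalIntegrable_integral_comp hφ 0 T)
          (intervalIntegrable_const.add hgenint) fun s _ => ?_
        have hgen_s := hX.integrable_comp hgen s.toNNReal
        refine (integral_mono (hX.integrable_comp hφ _) ((integrable_const c).add hgen_s)
          fun ω => h _).trans_eq ?_
        simp only [Pi.add_apply]
        rw [integral_add (integrable_const c) hgen_s]
        simp
    _ = T * c + ∫ ω, f (X T ω) - f (X 0 ω) ∂P := by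
        have hdynkin := hX.integral_integral_mul_generator (zero_le : 0 ≤ T) (integrable_const 1)
          stronglyMeasurable_const f
        simp only [one_mul, NNReal.coe_zero] at hdynkin
        rw [intervalIntegral.integral_add intervalIntegrable_const hgenint, hdynkin]
        simp

lemma integral_integral_indicator_le (hX : IsWalk X P x) (y : ℤ) (T : ℝ≥0) {δ : ℝ} (hδ : 0 < δ)
    (hδ' : δ ≤ 1) :
    ∫ s in (0 : ℝ)..T, ∫ ω, Set.indicator {y} (fun _ => (1 : ℝ)) (X s.toNNReal ω) ∂P ≤
      1 / δ + T * δ / 2 := by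
  have := hX.isProbabilityMeasure
  have hpow : ∀ k : ℕ, 0 ≤ (1 - δ) ^ k ∧ (1 - δ) ^ k ≤ 1 := fun k =>
    ⟨pow_nonneg (by linarith) k, pow_le_one₀ (by linarith) (by linarith)⟩
  let potential : ℤ →ᵇ ℝ := BoundedContinuousFunction.ofNormedAddCommGroupDiscrete
    (fun z => -(1 - δ) ^ (z - y).natAbs / δ) (1 / δ) fun z => by
      rw [Real.norm_eq_abs, abs_div, abs_neg, abs_of_pos hδ, abs_of_nonneg (hpow _).1]
      gcongr
      exact (hpow _).2
  have hosc : ∀ ω, potential (X T ω) - potential (X 0 ω) ≤ 1 / δ := fun ω => by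
    change -(1 - δ) ^ (X T ω - y).natAbs / δ - -(1 - δ) ^ (X 0 ω - y).natAbs / δ ≤ 1 / δ
    rw [← sub_div]
    gcongr
    linarith [(hpow (X T ω - y).natAbs).1, (hpow (X 0 ω - y).natAbs).2]
  have hpot : ∀ z, |potential z| ≤ ‖potential‖ := potential.norm_coe_le_norm
  have hincrement : ∫ ω, potential (X T ω) - potential (X 0 ω) ∂P ≤ 1 / δ := by
    simpa using integral_mono ((hX.integrable_comp hpot T).sub (hX.integrable_comp hpot 0))
      (integrable_const (1 / δ)) hosc
  have hoccupation := hX.integral_integral_comp_le (f := potential) (abs_indicator_singleton_le y)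
    (indicator_singleton_le_generator_potential hδ hδ' y) T
  linarith

lemma measurable_localTime (hX : IsWalk X P x) (y : ℤ) (T : ℝ≥0) :
    Measurable (localTime X y T) := by
  unfold localTime
  simp only [intervalIntegral.integral_of_le T.coe_nonneg]
  exact (hX.measurable_comp_uncurry _).stronglyMeasurable.integral_prod_left.measurable

lemma memLp_localTime (hX : IsWalk X P x) (y : ℤ) (T : ℝ≥0) (p : ENNReal) :
    MemLp (localTime X y T) p P :=
  have := hX.isProbabilityMeasure
  .of_bound (hX.measurable_localTime y T).aestronglyMeasurable T
    (ae_of_all _ (abs_localTime_le X y T))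

lemma localTime_sub_localTime (hX : IsWalk X P x) (y : ℤ) (T : ℝ≥0) (ω : Ω) :
    localTime X y T ω - localTime X (y - 1) T ω =
      ∫ s in (0 : ℝ)..T, generator (fun z => if y ≤ z then -1 else 1) (X s.toNNReal ω) := by
  simp only [generator_step]
  exact (intervalIntegral.integral_sub
    (hX.intervalIntegrable_comp (abs_indicator_singleton_le y) ω 0 T)
    (hX.intervalIntegrable_comp (abs_indicator_singleton_le (y - 1)) ω 0 T)).symm

lemma integral_sq_localTime_sub_le (hX : IsWalk X P x) (y : ℤ) (T : ℝ≥0) {δ : ℝ} (hδ : 0 < δ)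
    (hδ' : δ ≤ 1) :
    ∫ ω, (localTime X y T ω - localTime X (y - 1) T ω) ^ 2 ∂P ≤ 8 / δ + 4 * T * δ := by
  have hstep : ∀ z : ℤ, ‖if y ≤ z then (-1 : ℝ) else 1‖ ≤ 1 := fun z => by split_ifs <;> simp
  let step : ℤ →ᵇ ℝ := BoundedContinuousFunction.ofNormedAddCommGroupDiscrete _ 1 hstep
  have hnorm : ‖step‖ ≤ 1 := (BoundedContinuousFunction.norm_le zero_le_one).2 hstep
  have hoccupation : ∫ s in (0 : ℝ)..T, ∫ ω, |generator step (X s.toNNReal ω)| ∂P ≤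
      2 * (1 / δ + T * δ / 2) := by
    have habs : ∀ z, |generator step z| = Set.indicator {y} (fun _ => (1 : ℝ)) z +
        Set.indicator {y - 1} (fun _ => (1 : ℝ)) z := fun z => by
      refine (congrArg abs (generator_step y z)).trans ?_
      by_cases hy : z = y
      · simp [hy]
      · by_cases hy' : z = y - 1 <;> simp [hy, hy']
    simp only [habs, integral_add (hX.integrable_comp (abs_indicator_singleton_le y) _)
      (hX.integrable_comp (abs_indicator_singleton_le (y - 1)) _)]
    rw [intervalIntegral.integral_add
      (hX.intervalIntegrable_integral_comp (abs_indicator_singleton_le y) _ _)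
      (hX.intervalIntegrable_integral_comp (abs_indicator_singleton_le (y - 1)) _ _), two_mul]
    exact add_le_add (hX.integral_integral_indicator_le y T hδ hδ')
      (hX.integral_integral_indicator_le (y - 1) T hδ hδ')
  simp only [hX.localTime_sub_localTime]
  calc _ ≤ 4 * ‖step‖ * ∫ s in (0 : ℝ)..T, ∫ ω, |generator step (X s.toNNReal ω)| ∂P :=
        hX.integral_sq_integral_generator_le step T
    _ ≤ 4 * 1 * (2 * (1 / δ + T * δ / 2)) := by
        have hnonneg : 0 ≤ ∫ s in (0 : ℝ)..T, ∫ ω, |generator step (X s.toNNReal ω)| ∂P :=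
          intervalIntegral.integral_nonneg T.coe_nonneg fun _ _ =>
            integral_nonneg fun _ => abs_nonneg _
        gcongr
    _ = 8 / δ + 4 * T * δ := by ring

lemma integral_sq_localTime_sub_mul_sq_le (hX : IsWalk X P x) (y : ℤ) (t : ℝ≥0) {r : ℝ≥0}
    (hr : 1 ≤ r) :
    ∫ ω, (localTime X y (t * r ^ 2) ω - localTime X (y - 1) (t * r ^ 2) ω) ^ 2 ∂P ≤
      (8 + 4 * t) * r := by
  have hr' : (1 : ℝ) ≤ r := hr
  have hr_pos : (0 : ℝ) < r := by linarith
  refine (hX.integral_sq_localTime_sub_le y (t * r ^ 2) (δ := 1 / r) (by positivity)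
    ((div_le_one hr_pos).2 hr')).trans_eq ?_
  rw [NNReal.coe_mul, NNReal.coe_pow]
  field_simp

end IsWalk

end SimpleRandomWalk

end

theorem proposition4p5 (t : ℝ≥0) :
    ∃ C : ℝ, 0 < C ∧
      ∀ (Ω : Type*) [MeasurableSpace Ω] (P : Measure Ω) (X : ℝ≥0 → Ω → ℤ) (x : ℤ) (n : ℕ),
        1 ≤ n → SimpleRandomWalk.IsWalk X P x →
        (Integrable (fun ω => (SimpleRandomWalk.localTime X 0 (t * (n : ℝ≥0) ^ 2) ω / n -
            SimpleRandomWalk.localTime X (-1) (t * (n : ℝ≥0) ^ 2) ω / n) ^ 2) P ∧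
          ∫ ω, (SimpleRandomWalk.localTime X 0 (t * (n : ℝ≥0) ^ 2) ω / n -
            SimpleRandomWalk.localTime X (-1) (t * (n : ℝ≥0) ^ 2) ω / n) ^ 2 ∂P ≤ C * (1 / n)) ∧
        (Integrable (fun ω => |SimpleRandomWalk.localTime X 0 (t * (n : ℝ≥0) ^ 2) ω / n -
            SimpleRandomWalk.localTime X (-1) (t * (n : ℝ≥0) ^ 2) ω / n|) P ∧
          ∫ ω, |SimpleRandomWalk.localTime X 0 (t * (n : ℝ≥0) ^ 2) ω / n -
            SimpleRandomWalk.localTime X (-1) (t * (n : ℝ≥0) ^ 2) ω / n| ∂P ≤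
              C * (1 / Real.sqrt n)) := by
  refine ⟨8 + 4 * t, by positivity, fun Ω _ P X x n hn hX => ?_⟩
  have := hX.isProbabilityMeasure
  set T : ℝ≥0 := t * (n : ℝ≥0) ^ 2
  set D : Ω → ℝ := fun ω =>
    SimpleRandomWalk.localTime X 0 T ω / n - SimpleRandomWalk.localTime X (-1) T ω / n
  have hD : MemLp D 2 P := by
    simp only [D, div_eq_inv_mul]
    exact ((hX.memLp_localTime 0 T 2).const_mul _).sub ((hX.memLp_localTime (-1) T 2).const_mul _)
  have hsq : ∫ ω, D ω ^ 2 ∂P ≤ (8 + 4 * t) * (1 / n) := calc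
    ∫ ω, D ω ^ 2 ∂P = (∫ ω, (SimpleRandomWalk.localTime X 0 T ω -
        SimpleRandomWalk.localTime X (0 - 1) T ω) ^ 2 ∂P) / n ^ 2 := by
      simp only [D, ← sub_div, div_pow, integral_div, zero_sub]
    _ ≤ (8 + 4 * t) * n / n ^ 2 := by
      gcongr
      exact hX.integral_sq_localTime_sub_mul_sq_le 0 t (by exact_mod_cast hn)
    _ = (8 + 4 * t) * (1 / n) := by field_simp
  refine ⟨⟨hD.integrable_sq, hsq⟩, (hD.integrable one_le_two).abs, ?_⟩
  calc ∫ ω, |D ω| ∂P ≤ √((8 + 4 * t) * (1 / n)) :=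
        (integral_abs_le_sqrt_integral_sq hD).trans (Real.sqrt_le_sqrt hsq)
    _ = √(8 + 4 * t) * (1 / √n) := by
      rw [Real.sqrt_mul (by positivity), one_div, one_div, Real.sqrt_inv]
    _ ≤ (8 + 4 * t) * (1 / √n) := by
      gcongr
      exact Real.sqrt_le_self_iff.2 (Or.inr (by linarith [t.coe_nonneg]))
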